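/- A modal signature consists of a finite set $I$ of agents and a finite set $J$ of basic propositions; its first-order counterpart has a binary relation symbol $E_i$ for each $i\in I$ and a unary relation symbol $P_j$ for each $j\in J$. A Kripke structure over it is $\mathfrak M=(W,(E_i)_{i\in I},(P_j)_{j\in J})$ with $W\neq\emptyset$, $E_i\subseteq W\times W$ and $P_j\subseteq W$; write $E_i[u]=\{v\in W:(u,v)\in E_i\}$. A pointed Kripke structure $\mathfrak M,w$ has in addition a distinguished world $w\in W$, and it is finite if $W$ is finite. Formulas of graded modal logic $\mathrm{CML}$ are built from $\top$ and the propositions $p_j$ ($j\in J$) by $\neg,\wedge,\vee$ and the graded modalities $\Diamond_i^{\geq k}$ ($i\in I$, $k\geq 1$), where $\mathfrak M,u\models p_j$ iff $u\in P_j$, and $\mathfrak M,u\models\Diamond_i^{\geq k}\psi$ iff $|\{v\in E_i[u]:\mathfrak M,v\models\psi\}|\geq k$. Two pointed Kripke structures $\mathfrak M,w$ and $\mathfrak M',w'$ over the same signature are graded bisimilar, $\mathfrak M,w\sim_{\#}\mathfrak M',w'$, if there is a relation $Z\subseteq W\times W'$ with $(w,w')\in Z$ such that for all $(u,u')\in Z$: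 (a) $u\in P_j\Leftrightarrow u'\in P'_j$ for all $j\in J$; (b) for all $i\in I$, $k\geq 1$ and pairwise distinct $v_1,\dots,v_k\in E_i[u]$ there are pairwise distinct $v'_1,\dots,v'_k\in E'_i[u']$ with $(v_1,v'_1),\dots,(v_k,v'_k)\in Z$; (c) for all $i\in I$, $k\geq 1$ and pairwise distinct $v'_1,\dots,v'_k\in E'_i[u']$ there are pairwise distinct $v_1,\dots,v_k\in E_i[u]$ with $(v_1,v'_1),\dots,(v_k,v'_k)\in Z$. Theorem. For every first-order formula $\varphi(x)$ (with equality, in the single free variable $x$) in the first-order counterpart of a modal signature, the following are equivalent: (i) $\varphi$ is invariant under $\sim_{\#}$ within the class of all finite pointed Kripke structures over the signature: if $\mathfrak M,w$ and $\mathfrak M',w'$ are finite and $\mathfrak M,w\sim_{\#}\mathfrak M',w'$, then $\mathfrak M,w\models\varphi\Leftrightarrow\mathfrak M',w'\models\varphi$; (ii) over the class of all finite pointed Kripke structures, $\varphi$ is expressible in graded modal logic: there is $\psi\in\mathrm{CML}$ over the same signature such that $\mathfrak M,w\models\varphi\Leftrightarrow\mathfrak M,w\models\psi$ for all finite pointed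 Kripke structures $\mathfrak M,w$. -/

import Mathlib

universe u

namespace GradedModal

/-- The relation symbols of the first-order counterpart of the modal signature with agents `I` and
basic propositions `J`: a binary symbol for each agent, a unary symbol for each proposition. -/
inductive ModalRel (I J : Type u) : ℕ → Type u
  | acc : I → ModalRel I J 2
  | prop : J → ModalRel I J 1

/-- The first-order counterpart of the modal signature `(I, J)`; it is purely relational. -/
def modalLanguage (I J : Type u) : FirstOrder.Language.{0, u} where
  Functions := fun _ => Empty
  Relations := ModalRel I J

/-- A pointed Kripke structure `M, w` with `M = (W, (E_i), (P_j))`, where `w` is a world of `M`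
(so that the set of worlds is not empty). -/
structure PointedKripke (I J : Type u) where
  /-- the set `W` of worlds -/
  World : Type u
  /-- the accessibility relations `E_i` -/
  acc : I → World → World → Prop
  /-- the unary predicates `P_j` -/
  val : J → World → Prop
  /-- the distinguished world -/
  point : World

variable {I J : Type u}

/-- A Kripke structure, read as a first-order structure. -/
@[reducible]
def PointedKripke.toStructure (M : PointedKripke I J) :
    (modalLanguage I J).Structure M.World where
  funMap := fun f _ => Empty.elim f
  RelMap := fun r =>
    match r with
    | ModalRel.acc i => fun xs => M.acc i (xs 0) (xs 1)
    | ModalRel.prop j => fun xs => M.val j (xs 0)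

/-- `M, w ⊨ φ(x)` for a first-order formula (with equality) in the single free variable `x`,
to which the distinguished world `w` is assigned. -/
def PointedKripke.SatFO (M : PointedKripke I J) (φ : (modalLanguage I J).Formula (Fin 1)) : Prop :=
  letI := M.toStructure
  φ.Realize (fun _ : Fin 1 => M.point)

/-- Formulas of graded modal logic; `diam k i φ` says that at least `k ≥ 1` successors with respect
to agent `i` satisfy `φ`. -/
inductive CML (I J : Type u) : Type u
  | top : CML I J
  | atom : J → CML I J
  | neg : CML I J → CML I J
  | and : CML I J → CML I J → CML I J
  | or : CML I J → CML I J → CML I J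
  | diam : ℕ+ → I → CML I J → CML I J

/-- `M, u ⊨ ψ` for a formula `ψ` of graded modal logic and any world `u` of `M`. -/
def PointedKripke.SatAt (M : PointedKripke I J) : CML I J → M.World → Prop
  | CML.top, _ => True
  | CML.atom j, u => M.val j u
  | CML.neg ψ, u => ¬ M.SatAt ψ u
  | CML.and ψ χ, u => M.SatAt ψ u ∧ M.SatAt χ u
  | CML.or ψ χ, u => M.SatAt ψ u ∨ M.SatAt χ u
  | CML.diam k i ψ, u => ((k : ℕ) : ℕ∞) ≤ {v : M.World | M.acc i u v ∧ M.SatAt ψ v}.encard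

/-- `M, w ⊨ ψ` at the distinguished world `w`. -/
def PointedKripke.SatCML (M : PointedKripke I J) (ψ : CML I J) : Prop :=
  M.SatAt ψ M.point

/-- `Z` is a graded bisimulation relation between the Kripke structures underlying `M` and `N`. -/
structure IsGradedBisimulation (M N : PointedKripke I J) (Z : M.World → N.World → Prop) :
    Prop where
  nonempty : ∃ u u', Z u u'
  atom : ∀ u u', Z u u' → ∀ j, M.val j u ↔ N.val j u'
  forth : ∀ u u', Z u u' → ∀ (i : I) (k : ℕ), 1 ≤ k → ∀ v : Fin k → M.World,
    Function.Injective v → (∀ m, M.acc i u (v m)) →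
      ∃ v' : Fin k → N.World,
        Function.Injective v' ∧ (∀ m, N.acc i u' (v' m)) ∧ ∀ m, Z (v m) (v' m)
  back : ∀ u u', Z u u' → ∀ (i : I) (k : ℕ), 1 ≤ k → ∀ v' : Fin k → N.World,
    Function.Injective v' → (∀ m, N.acc i u' (v' m)) →
      ∃ v : Fin k → M.World,
        Function.Injective v ∧ (∀ m, M.acc i u (v m)) ∧ ∀ m, Z (v m) (v' m)

/-- Graded bisimilarity of pointed Kripke structures. -/
def GradedBisimilar (M N : PointedKripke I J) : Prop :=
  ∃ Z : M.World → N.World → Prop, IsGradedBisimulation M N Z ∧ Z M.point N.point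

/-- `φ(x)` is invariant under graded bisimilarity within the class of all finite pointed Kripke
structures. -/
def InvariantFin (φ : (modalLanguage I J).Formula (Fin 1)) : Prop :=
  ∀ M N : PointedKripke I J, Finite M.World → Finite N.World →
    GradedBisimilar M N → (M.SatFO φ ↔ N.SatFO φ)

/-- `φ(x)` and `ψ` are equivalent over the class of all finite pointed Kripke structures. -/
def EquivFin (φ : (modalLanguage I J).Formula (Fin 1)) (ψ : CML I J) : Prop :=
  ∀ M : PointedKripke I J, Finite M.World → (M.SatFO φ ↔ M.SatCML ψ)

end GradedModal

/-!
Formulas of graded modal logic are preserved by graded bisimulations by induction on the formula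
(`IsGradedBisimulation.satAt_iff`). For the converse, let `φ` be invariant over finite structures and
of quantifier rank `q`, and put `l = 2 ^ q`.

*Locality.* `φ` does not distinguish `M` from the tree unravelling of `M` cut at depth `l`, although
this tree is not bisimilar to `M` (`InvariantFin.satFO_tree_iff`). Namely, `M` is bisimilar to the
finite structure `unravel M l`, a tree up to depth `l` whose leaves lead into one copy of `M`. Adding
disjoint copies changes nothing up to bisimilarity, so each of `unravel M l` and its cut version may
be accompanied by `q + 1` copies of both. The two resulting structures agree on `φ`
(`satFO_copies_iff`): in the Ehrenfeucht–Fraïssé game the duplicator always answers with a copy of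
the same world, in the corresponding copy if the world is near an earlier one, and in a fresh copy of
the same kind otherwise.

*Trees.* Two such trees agree on `φ` if their roots satisfy the same formulas of a certain finite
set, which describe `l` levels of the tree and count up to a large threshold
(`satFO_tree_iff_of_typeAt_eq`). The duplicator keeps a finite matching of paths, closed under initial
segments, that preserves types; as the matching is smaller than the threshold, a new branch can always
be answered by a new branch of the same type (`IsTreeMatching.exists_step`).

Hence the truth of `φ` depends only on which formulas of a finite set hold at the distinguished world,
so `φ` is equivalent to a disjunction of characteristic formulas (`exists_equivFin_of_typeAt`).
-/

namespace GradedModal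

variable {I J : Type u}

/-! ### Graded bisimulations -/

/-- A map that preserves the propositions and restricts, for every agent, to a bijection between the
successors of a world and the successors of its image is a graded bisimulation. -/
theorem GradedBisimilar.of_bijOn {M N : PointedKripke I J} (f : M.World → N.World)
    (hpoint : f M.point = N.point) (hval : ∀ u j, M.val j u ↔ N.val j (f u))
    (hacc : ∀ i u, Set.BijOn f {v | M.acc i u v} {v | N.acc i (f u) v}) :
    GradedBisimilar M N := by
  refine ⟨fun u u' => f u = u', ⟨⟨_, _, hpoint⟩, ?_, ?_, ?_⟩, hpoint⟩
  · rintro u _ rfl j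
    exact hval u j
  · rintro u _ rfl i k - v hv hacc_v
    refine ⟨fun m => f (v m), fun m m' h => ?_, fun m => (hacc i u).mapsTo (hacc_v m),
      fun _ => rfl⟩
    exact hv ((hacc i u).injOn (hacc_v m) (hacc_v m') h)
  · rintro u _ rfl i k - v' hv' hacc_v
    choose v hv hfv using fun m => (hacc i u).surjOn (hacc_v m)
    refine ⟨v, fun m m' h => hv' ?_, hv, hfv⟩
    rw [← hfv m, ← hfv m', h]

theorem le_encard_iff_exists_injective {α : Type*} {s : Set α} {k : ℕ} :
    (k : ℕ∞) ≤ s.encard ↔ ∃ v : Fin k → α, Function.Injective v ∧ ∀ m, v m ∈ s := by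
  constructor
  · intro h
    obtain ⟨t, hts, ht⟩ := Set.exists_subset_encard_eq h
    have hfin : t.Finite := Set.finite_of_encard_eq_coe ht
    have : Fintype t := hfin.fintype
    have hcard : Fintype.card t = k := by
      rw [← Nat.card_eq_fintype_card, Nat.card_coe_set_eq, Set.ncard, ht]; rfl
    let e := (Fintype.equivFinOfCardEq hcard).symm
    exact ⟨fun m => e m, Subtype.val_injective.comp e.injective, fun m => hts (e m).2⟩
  · rintro ⟨v, hv, hs⟩
    calc (k : ℕ∞) = (Set.range v).encard := by
          rw [← Set.image_univ, hv.encard_image, Set.encard_univ]; simp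
      _ ≤ s.encard := Set.encard_le_encard (by rintro _ ⟨m, rfl⟩; exact hs m)

theorem IsGradedBisimulation.satAt_iff {M N : PointedKripke I J}
    {Z : M.World → N.World → Prop} (hZ : IsGradedBisimulation M N Z) (ψ : CML I J) :
    ∀ {u u'}, Z u u' → (M.SatAt ψ u ↔ N.SatAt ψ u') := by
  induction ψ with
  | top => intros; rfl
  | atom j => exact fun h => hZ.atom _ _ h j
  | neg ψ ih => exact fun h => not_congr (ih h)
  | and ψ χ ih₁ ih₂ => exact fun h => and_congr (ih₁ h) (ih₂ h)
  | or ψ χ ih₁ ih₂ => exact fun h => or_congr (ih₁ h) (ih₂ h)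
  | diam k i ψ ih =>
    intro u u' h
    simp only [PointedKripke.SatAt, le_encard_iff_exists_injective, Set.mem_ofPred_eq]
    constructor
    · rintro ⟨v, hv, hs⟩
      obtain ⟨v', hv', hacc, hZv⟩ := hZ.forth u u' h i k k.2 v hv fun m => (hs m).1
      exact ⟨v', hv', fun m => ⟨hacc m, (ih (hZv m)).1 (hs m).2⟩⟩
    · rintro ⟨v', hv', hs⟩
      obtain ⟨v, hv, hacc, hZv⟩ := hZ.back u u' h i k k.2 v' hv' fun m => (hs m).1
      exact ⟨v, hv, fun m => ⟨hacc m, (ih (hZv m)).2 (hs m).2⟩⟩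

/-! ### Ehrenfeucht–Fraïssé games -/

/-- The maximal nesting depth of quantifiers in a first-order formula. -/
def quantifierRank {L : FirstOrder.Language} {α : Type*} :
    ∀ {n : ℕ}, L.BoundedFormula α n → ℕ
  | _, .falsum => 0
  | _, .equal _ _ => 0
  | _, .rel _ _ => 0
  | _, .imp φ χ => max (quantifierRank φ) (quantifierRank χ)
  | _, .all φ => quantifierRank φ + 1

/-- A set of matched pairs is a partial isomorphism. -/
structure IsPartialIso (M N : PointedKripke I J) (L : Set (M.World × N.World)) : Prop where
  eq_iff : ∀ p ∈ L, ∀ q ∈ L, p.1 = q.1 ↔ p.2 = q.2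
  acc_iff : ∀ p ∈ L, ∀ q ∈ L, ∀ i, M.acc i p.1 q.1 ↔ N.acc i p.2 q.2
  val_iff : ∀ p ∈ L, ∀ j, M.val j p.1 ↔ N.val j p.2

/-- A winning strategy for the duplicator in the Ehrenfeucht–Fraïssé game: `S m L` says that
the position given by the list `L` of matched pairs is safe with `m` rounds left. -/
structure IsStrategy (M N : PointedKripke I J)
    (S : ℕ → List (M.World × N.World) → Prop) : Prop where
  isPartialIso : ∀ m L, S m L → IsPartialIso M N {p | p ∈ L}
  forth : ∀ m L, S (m + 1) L → ∀ a, ∃ b, S m ((a, b) :: L)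
  back : ∀ m L, S (m + 1) L → ∀ b, ∃ a, S m ((a, b) :: L)

theorem IsStrategy.realize_iff {M N : PointedKripke I J}
    {S : ℕ → List (M.World × N.World) → Prop} (hS : IsStrategy M N S) {α : Type*} {n : ℕ}
    (φ : (modalLanguage I J).BoundedFormula α n) :
    ∀ {m : ℕ} {L : List (M.World × N.World)} {v : α → M.World} {v' : α → N.World}
      {x : Fin n → M.World} {x' : Fin n → N.World}, quantifierRank φ ≤ m → S m L →
      (∀ a, (v a, v' a) ∈ L) → (∀ a, (x a, x' a) ∈ L) →
      (@FirstOrder.Language.BoundedFormula.Realize _ M.World M.toStructure _ _ φ v x ↔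
        @FirstOrder.Language.BoundedFormula.Realize _ N.World N.toStructure _ _ φ v' x') := by
  have hterm : ∀ {n : ℕ} {L : List (M.World × N.World)} {v : α → M.World} {v' : α → N.World}
      {x : Fin n → M.World} {x' : Fin n → N.World},
      (∀ a, (v a, v' a) ∈ L) → (∀ a, (x a, x' a) ∈ L) →
      ∀ t : (modalLanguage I J).Term (α ⊕ Fin n),
        (@FirstOrder.Language.Term.realize _ M.World M.toStructure _ (Sum.elim v x) t,
          @FirstOrder.Language.Term.realize _ N.World N.toStructure _ (Sum.elim v' x') t) ∈ L := by
    intro n L v v' x x' hv hx t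
    match t with
    | .var (.inl a) => exact hv a
    | .var (.inr a) => exact hx a
    | .func f _ => exact f.elim
  induction φ with
  | falsum => intros; rfl
  | equal t₁ t₂ =>
    intro m L v v' x x' _ hL hv hx
    exact (hS.isPartialIso m L hL).eq_iff _ (hterm hv hx t₁) _ (hterm hv hx t₂)
  | rel R ts =>
    intro m L v v' x x' _ hL hv hx
    cases R with
    | acc i =>
      exact (hS.isPartialIso m L hL).acc_iff _ (hterm hv hx (ts 0)) _ (hterm hv hx (ts 1)) i
    | prop j => exact (hS.isPartialIso m L hL).val_iff _ (hterm hv hx (ts 0)) j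
  | imp φ χ ih₁ ih₂ =>
    intro m L v v' x x' hm hL hv hx
    have hm' : max (quantifierRank φ) (quantifierRank χ) ≤ m := hm
    exact imp_congr (ih₁ (le_of_max_le_left hm') hL hv hx) (ih₂ (le_of_max_le_right hm') hL hv hx)
  | @all k φ ih =>
    intro m L v v' x x' hm hL hv hx
    obtain ⟨m, rfl⟩ : ∃ m', m = m' + 1 := ⟨m - 1, by have : quantifierRank φ + 1 ≤ m := hm; omega⟩
    have hφ : quantifierRank φ ≤ m := Nat.le_of_succ_le_succ hm
    have hsnoc : ∀ a b, ∀ i : Fin (k + 1),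
        ((Fin.snoc x a : Fin (k + 1) → M.World) i, (Fin.snoc x' b : Fin (k + 1) → N.World) i) ∈
          (a, b) :: L := by
      intro a b i
      refine Fin.lastCases ?_ (fun i => ?_) i
      · simp
      · simpa using Or.inr (hx i)
    constructor
    · intro h b
      obtain ⟨a, hab⟩ := hS.back m L hL b
      exact (ih hφ hab (fun a => List.mem_cons_of_mem _ (hv a)) (hsnoc a b)).1 (h a)
    · intro h a
      obtain ⟨b, hab⟩ := hS.forth m L hL a
      exact (ih hφ hab (fun a => List.mem_cons_of_mem _ (hv a)) (hsnoc a b)).2 (h b)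

theorem IsStrategy.satFO_iff {M N : PointedKripke I J}
    {S : ℕ → List (M.World × N.World) → Prop} (hS : IsStrategy M N S)
    (φ : (modalLanguage I J).Formula (Fin 1))
    (h : S (quantifierRank φ) [(M.point, N.point)]) : M.SatFO φ ↔ N.SatFO φ :=
  hS.realize_iff φ le_rfl h (fun _ => List.mem_singleton_self _) (fun a => a.elim0)

/-! ### Copies of a structure cut at a given depth -/

/-- Worlds related by a path of length at most `2 ^ m` along edges taken in either direction. -/
def Near (M : PointedKripke I J) : ℕ → M.World → M.World → Prop
  | 0, u, v => u = v ∨ ∃ i, M.acc i u v ∨ M.acc i v u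
  | m + 1, u, v => ∃ x, Near M m u x ∧ Near M m x v

theorem Near.refl {M : PointedKripke I J} : ∀ m (u : M.World), Near M m u u
  | 0, _ => Or.inl rfl
  | m + 1, u => ⟨u, Near.refl m u, Near.refl m u⟩

theorem Near.symm {M : PointedKripke I J} : ∀ {m} {u v : M.World}, Near M m u v → Near M m v u
  | 0, _, _, .inl h => .inl h.symm
  | 0, _, _, .inr ⟨i, h⟩ => .inr ⟨i, h.symm⟩
  | _ + 1, _, _, ⟨x, h₁, h₂⟩ => ⟨x, h₂.symm, h₁.symm⟩

theorem Near.zero_le {M : PointedKripke I J} {u v : M.World} (h : Near M 0 u v) :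
    ∀ m, Near M m u v
  | 0 => h
  | m + 1 => ⟨v, h.zero_le m, Near.refl m v⟩

theorem Near.succ {M : PointedKripke I J} {m : ℕ} {u v : M.World} (h : Near M m u v) :
    Near M (m + 1) u v :=
  ⟨v, h, Near.refl m v⟩

/-- A function on worlds that changes by at most one along each edge. -/
def IsDepth (M : PointedKripke I J) (h : M.World → ℕ) : Prop :=
  ∀ i u v, M.acc i u v → h u ≤ h v + 1 ∧ h v ≤ h u + 1

theorem IsDepth.le_of_near {M : PointedKripke I J} {h : M.World → ℕ} (hh : IsDepth M h) :
    ∀ {m} {u v : M.World}, Near M m u v → h u ≤ h v + 2 ^ m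
  | 0, _, _, .inl e => by simp [e]
  | 0, _, _, .inr ⟨i, .inl e⟩ => by simpa using (hh i _ _ e).1
  | 0, _, _, .inr ⟨i, .inr e⟩ => by simpa using (hh i _ _ e).2
  | m + 1, u, v, ⟨x, h₁, h₂⟩ => by
    have := hh.le_of_near h₁
    have := hh.le_of_near h₂
    rw [pow_succ]
    omega

/-- The indices of the copies used in `copies`: a distinguished one, and `n` further ones of either
kind (`true` for whole copies, `false` for cut ones). -/
abbrev CopyIndex (n : ℕ) : Type := Option (Bool × Fin n)

/-- The kind of a copy; the argument `b` is the kind of the distinguished copy. -/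
def copyKind {n : ℕ} (b : Bool) : CopyIndex n → Bool
  | none => b
  | some k => k.1

/-- The disjoint sum of copies of `M`, where a copy of kind `true` is all of `M` and a copy of kind
`false` is the part of `M` of depth at most `l`. The distinguished copy is of kind `b` and contains
the distinguished world. -/
def copies (M : PointedKripke I J) (h : M.World → ℕ) (l : ℕ) (hl : h M.point ≤ l) (n : ℕ)
    (b : Bool) : PointedKripke I J where
  World := {p : CopyIndex n × M.World // copyKind b p.1 = true ∨ h p.2 ≤ l}
  acc i p q := p.1.1 = q.1.1 ∧ M.acc i p.1.2 q.1.2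
  val j p := M.val j p.1.2
  point := ⟨(none, M.point), Or.inr hl⟩

theorem finite_copies (M : PointedKripke I J) [Finite M.World] (h : M.World → ℕ) (l : ℕ)
    (hl : h M.point ≤ l) (n : ℕ) (b : Bool) : Finite (copies M h l hl n b).World :=
  inferInstanceAs (Finite {p : CopyIndex n × M.World // copyKind b p.1 = true ∨ h p.2 ≤ l})

/-- Positions in the game on `copies M h l hl n b` and `copies M h l hl n b'` that are safe with `m`
rounds left: matched elements are copies of the same world of `M`; if they lie in copies of
different kinds, then their distance from the cut is at least `2 ^ m`; and elements that are near
each other in `M` lie in the same copy on one side if and only if they do so on the other. The bound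
on the number of pairs leaves an unused copy of each kind for the next move. -/
structure CopyPosition (M : PointedKripke I J) (h : M.World → ℕ) (l : ℕ) (hl : h M.point ≤ l)
    (n : ℕ) (b b' : Bool) (m : ℕ)
    (L : List ((copies M h l hl n b).World × (copies M h l hl n b').World)) : Prop where
  length_le : L.length + m ≤ n
  base_eq : ∀ p ∈ L, p.1.1.2 = p.2.1.2
  depth_le : ∀ p ∈ L, copyKind b p.1.1.1 ≠ copyKind b' p.2.1.1 → h p.1.1.2 + 2 ^ m ≤ l
  copy_iff : ∀ p ∈ L, ∀ q ∈ L, Near M m p.1.1.2 q.1.1.2 →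
    (p.1.1.1 = q.1.1.1 ↔ p.2.1.1 = q.2.1.1)

theorem CopyPosition.swap {M : PointedKripke I J} {h : M.World → ℕ} {l : ℕ} {hl : h M.point ≤ l}
    {n : ℕ} {b b' : Bool} {m : ℕ}
    {L : List ((copies M h l hl n b).World × (copies M h l hl n b').World)}
    (H : CopyPosition M h l hl n b b' m L) :
    CopyPosition M h l hl n b' b m (L.map Prod.swap) where
  length_le := by simpa using H.length_le
  base_eq := by
    intro p hp
    obtain ⟨p, hp', rfl⟩ := List.mem_map.1 hp
    exact (H.base_eq p hp').symm
  depth_le := by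
    intro p hp hne
    obtain ⟨p, hp', rfl⟩ := List.mem_map.1 hp
    have := H.depth_le p hp' fun e => hne e.symm
    rwa [H.base_eq p hp'] at this
  copy_iff := by
    intro p hp q hq hnear
    obtain ⟨p, hp', rfl⟩ := List.mem_map.1 hp
    obtain ⟨q, hq', rfl⟩ := List.mem_map.1 hq
    refine (H.copy_iff p hp' q hq' ?_).symm
    rw [H.base_eq p hp', H.base_eq q hq']
    exact hnear

theorem CopyPosition.forth {M : PointedKripke I J} {h : M.World → ℕ} (hh : IsDepth M h) {l : ℕ}
    {hl : h M.point ≤ l} {n : ℕ} {b b' : Bool} {m : ℕ}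
    {L : List ((copies M h l hl n b).World × (copies M h l hl n b').World)}
    (H : CopyPosition M h l hl n b b' (m + 1) L) (x : (copies M h l hl n b).World) :
    ∃ y, CopyPosition M h l hl n b b' m ((x, y) :: L) := by
  have hlen := H.length_le
  -- It suffices to find `y` over the same world as `x` that fits with the earlier pairs.
  suffices ∃ y : (copies M h l hl n b').World, x.1.2 = y.1.2 ∧
      (copyKind b x.1.1 ≠ copyKind b' y.1.1 → h x.1.2 + 2 ^ m ≤ l) ∧
      ∀ p ∈ L, Near M m p.1.1.2 x.1.2 → (p.1.1.1 = x.1.1 ↔ p.2.1.1 = y.1.1) by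
    obtain ⟨y, hbase, hdepth, hcopy⟩ := this
    refine ⟨y, ⟨by simp only [List.length_cons]; omega, ?_, ?_, ?_⟩⟩
    · intro p hp
      rcases List.mem_cons.1 hp with rfl | hp
      exacts [hbase, H.base_eq p hp]
    · intro p hp hne
      rcases List.mem_cons.1 hp with rfl | hp
      · exact hdepth hne
      · have := H.depth_le p hp hne
        rw [pow_succ] at this
        omega
    · intro p hp q hq hnear
      rcases List.mem_cons.1 hp with rfl | hp <;> rcases List.mem_cons.1 hq with rfl | hq
      · simp
      · rw [eq_comm, hcopy q hq hnear.symm, eq_comm]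
      · exact hcopy p hp hnear
      · exact H.copy_iff p hp q hq hnear.succ
  by_cases hx : ∃ p ∈ L, p.1.1.1 = x.1.1 ∧ Near M m p.1.1.2 x.1.2
  · -- `x` is near an earlier element of its copy; the answer lies in the corresponding copy.
    obtain ⟨p, hp, hpx, hnear⟩ := hx
    have hdepth : copyKind b x.1.1 ≠ copyKind b' p.2.1.1 → h x.1.2 + 2 ^ m ≤ l := by
      intro hne
      have h₁ := H.depth_le p hp (by rwa [hpx])
      have h₂ := hh.le_of_near hnear.symm
      rw [pow_succ] at h₁
      omega
    refine ⟨⟨(p.2.1.1, x.1.2), ?_⟩, rfl, hdepth, fun q hq hqx => ?_⟩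
    · by_cases hk : copyKind b x.1.1 = copyKind b' p.2.1.1
      · exact hk ▸ x.2
      · exact Or.inr (le_of_add_le_left (hdepth hk))
    · change _ = x.1.1 ↔ _ = p.2.1.1
      rw [← hpx]
      exact H.copy_iff q hq p hp ⟨x.1.2, hqx, hnear.symm⟩
  · -- Otherwise the answer lies in a copy of the same kind without earlier elements.
    obtain ⟨k, hk⟩ : ∃ k : Fin n, ∀ p ∈ L, p.2.1.1 ≠ some (copyKind b x.1.1, k) := by
      by_contra! hcon
      choose f hf hfk using hcon
      have hsub : (Finset.univ : Finset (Fin n)).card ≤ L.length := by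
        classical
        refine (Finset.card_le_card_of_injOn f (t := L.toFinset)
          (fun k _ => by simpa using hf k) fun k _ k' _ e => ?_).trans L.toFinset_card_le
        have := (hfk k).symm.trans (e ▸ hfk k')
        simpa using this
      rw [Finset.card_univ, Fintype.card_fin] at hsub
      omega
    refine ⟨⟨(some (copyKind b x.1.1, k), x.1.2), x.2⟩, rfl, fun hne => (hne rfl).elim,
      fun p hp hnear => ⟨fun e => (hx ⟨p, hp, e, hnear⟩).elim, fun e => (hk p hp e).elim⟩⟩

theorem isStrategy_copyPosition {M : PointedKripke I J} {h : M.World → ℕ} (hh : IsDepth M h)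
    {l : ℕ} {hl : h M.point ≤ l} {n : ℕ} {b b' : Bool} :
    IsStrategy (copies M h l hl n b) (copies M h l hl n b') (CopyPosition M h l hl n b b') where
  isPartialIso m L H := by
    refine ⟨fun p hp q hq => ?_, fun p hp q hq i => ?_, fun p hp j => ?_⟩
    · refine Subtype.ext_iff.trans (Iff.trans ?_ Subtype.ext_iff.symm)
      rw [Prod.ext_iff, Prod.ext_iff, ← H.base_eq p hp, ← H.base_eq q hq]
      refine and_congr_left fun e => H.copy_iff p hp q hq ?_
      rw [e]
      exact Near.refl m _
    · change _ ∧ _ ↔ _ ∧ _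
      rw [← H.base_eq p hp, ← H.base_eq q hq]
      exact and_congr_left fun e => H.copy_iff p hp q hq
        (Near.zero_le (Or.inr ⟨i, Or.inl e⟩) m)
    · change M.val _ _ ↔ M.val _ _
      rw [H.base_eq p hp]
  forth m L H x := H.forth hh x
  back m L H y := by
    obtain ⟨x, hx⟩ := H.swap.forth hh y
    refine ⟨x, ?_⟩
    simpa [Function.comp_def] using hx.swap

/-- In the presence of enough further copies, `φ` does not tell whether the copy that contains the
distinguished world is cut, if the cut is deep enough. -/
theorem satFO_copies_iff {M : PointedKripke I J} {h : M.World → ℕ} (hh : IsDepth M h)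
    (h0 : h M.point = 0) (φ : (modalLanguage I J).Formula (Fin 1))
    (hl : h M.point ≤ 2 ^ quantifierRank φ) (b b' : Bool) :
    (copies M h (2 ^ quantifierRank φ) hl (quantifierRank φ + 1) b).SatFO φ ↔
      (copies M h (2 ^ quantifierRank φ) hl (quantifierRank φ + 1) b').SatFO φ := by
  refine (isStrategy_copyPosition hh).satFO_iff φ ⟨by simp [add_comm], ?_, ?_, ?_⟩
  · intro p hp
    rw [List.mem_singleton.1 hp]
    rfl
  · intro p hp _
    rw [List.mem_singleton.1 hp]
    exact (Nat.add_le_add_right h0.le _).trans (zero_add _).le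
  · intro p hp q hq _
    rw [List.mem_singleton.1 hp, List.mem_singleton.1 hq]
    exact iff_of_true rfl rfl

/-! ### Partial tree unravellings -/

/-- The last world of a path from the distinguished world. A path is the list of its steps in
reverse order, each step given by an agent and the world reached. -/
def endpoint (M : PointedKripke I J) : List (I × M.World) → M.World
  | [] => M.point
  | (_, v) :: _ => v

/-- Each step of the list follows an edge of its agent. -/
def IsPath (M : PointedKripke I J) : List (I × M.World) → Prop
  | [] => True
  | (i, v) :: p => M.acc i (endpoint M p) v ∧ IsPath M p

/-- The tree unravelling of `M` at its distinguished world, cut at depth `l`. -/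
def tree (M : PointedKripke I J) (l : ℕ) : PointedKripke I J where
  World := {p : List (I × M.World) // IsPath M p ∧ p.length ≤ l}
  acc i p q := ∃ v, q.1 = (i, v) :: p.1
  val j p := M.val j (endpoint M p.1)
  point := ⟨[], trivial, Nat.zero_le l⟩

theorem finite_tree [Finite I] (M : PointedKripke I J) [Finite M.World] (l : ℕ) :
    Finite (tree M l).World :=
  ((List.finite_length_le (I × M.World) l).subset fun _ h => h.2).to_subtype

/-- The unravelling of `M` up to depth `l`: the tree of depth `l`, the leaves of which have their
successors in one additional copy of `M`. -/
def unravel (M : PointedKripke I J) (l : ℕ) : PointedKripke I J where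
  World := (tree M l).World ⊕ M.World
  acc i
    | .inl p, .inl q => (tree M l).acc i p q
    | .inl p, .inr v => p.1.length = l ∧ M.acc i (endpoint M p.1) v
    | .inr u, .inr v => M.acc i u v
    | .inr _, .inl _ => False
  val j
    | .inl p => (tree M l).val j p
    | .inr v => M.val j v
  point := .inl (tree M l).point

theorem finite_unravel [Finite I] (M : PointedKripke I J) [Finite M.World] (l : ℕ) :
    Finite (unravel M l).World :=
  have := finite_tree M l
  inferInstanceAs (Finite ((tree M l).World ⊕ M.World))

theorem gradedBisimilar_unravel (M : PointedKripke I J) (l : ℕ) :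
    GradedBisimilar (unravel M l) M := by
  let f : (unravel M l).World → M.World := Sum.elim (fun p => endpoint M p.1) id
  refine .of_bijOn f rfl ?_ fun i u => ⟨?_, ?_, ?_⟩
  · rintro (p | v) j <;> rfl
  · rintro (q | v) h
    · obtain p | u := u
      · obtain ⟨v, hv⟩ := h
        have := q.2.1
        rw [hv] at this
        change M.acc i (endpoint M p.1) (endpoint M q.1)
        rw [hv]
        exact this.1
      · exact h.elim
    · obtain p | u := u
      · exact h.2
      · exact h
  · obtain p | u := u
    · rintro (q | v) hq (q' | v') hq' e
      · obtain ⟨v, hv⟩ := hq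
        obtain ⟨v', hv'⟩ := hq'
        have e' : endpoint M q.1 = endpoint M q'.1 := e
        rw [hv, hv'] at e'
        have e'' : v = v' := e'
        exact congrArg Sum.inl (Subtype.ext (by rw [hv, hv', e'']))
      · obtain ⟨v, hv⟩ := hq
        have := q.2.2
        rw [hv, List.length_cons, hq'.1] at this
        omega
      · obtain ⟨v', hv'⟩ := hq'
        have := q'.2.2
        rw [hv', List.length_cons, hq.1] at this
        omega
      · exact congrArg Sum.inr e
    · rintro (q | v) hq (q' | v') hq' e
      · exact hq.elim
      · exact hq.elim
      · exact hq'.elim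
      · exact congrArg Sum.inr e
  · intro v hv
    obtain p | u := u
    · by_cases hp : p.1.length = l
      · exact ⟨.inr v, ⟨hp, hv⟩, rfl⟩
      · have hlen : p.1.length < l := lt_of_le_of_ne p.2.2 hp
        exact ⟨.inl ⟨(i, v) :: p.1, ⟨hv, p.2.1⟩, hlen⟩, ⟨v, rfl⟩, rfl⟩
    · exact ⟨.inr v, hv, rfl⟩

/-- The depth of a world in the unravelling. -/
def unravelDepth (M : PointedKripke I J) (l : ℕ) : (unravel M l).World → ℕ
  | .inl p => p.1.length
  | .inr _ => l + 1

theorem isDepth_unravelDepth (M : PointedKripke I J) (l : ℕ) :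
    IsDepth (unravel M l) (unravelDepth M l) := by
  rintro i (p | u) (q | v) h
  · obtain ⟨v, hv⟩ := h
    simp [unravelDepth, hv, add_assoc]
  · simp [unravelDepth, h.1, add_assoc]
  · exact h.elim
  · simp [unravelDepth]

theorem gradedBisimilar_copies (M : PointedKripke I J) (h : M.World → ℕ) (l : ℕ)
    (hl : h M.point ≤ l) (n : ℕ) : GradedBisimilar M (copies M h l hl n true) := by
  refine .of_bijOn (fun u => ⟨(none, u), Or.inl rfl⟩) rfl (fun _ _ => Iff.rfl)
    fun i u => ⟨fun v hv => ⟨rfl, hv⟩, fun v _ v' _ e => ?_, ?_⟩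
  · exact (Prod.ext_iff.1 (Subtype.ext_iff.1 e)).2
  · rintro ⟨⟨k, v⟩, hv⟩ ⟨rfl, hacc⟩
    exact ⟨v, hacc, rfl⟩

/-- The part of depth at most `l` of the unravelling is the tree of depth `l`. -/
theorem gradedBisimilar_tree_copies (M : PointedKripke I J) (l : ℕ)
    (hl : unravelDepth M l (unravel M l).point ≤ l) (n : ℕ) :
    GradedBisimilar (tree M l) (copies (unravel M l) (unravelDepth M l) l hl n false) := by
  refine .of_bijOn (fun p => ⟨(none, .inl p), Or.inr p.2.2⟩) rfl (fun _ _ => Iff.rfl)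
    fun i u => ⟨fun v hv => ⟨rfl, hv⟩, fun v _ v' _ e => ?_, ?_⟩
  · exact Sum.inl_injective (Prod.ext_iff.1 (Subtype.ext_iff.1 e)).2
  · rintro ⟨⟨k, p | v⟩, hv⟩ ⟨rfl, hacc⟩
    · exact ⟨p, hacc, rfl⟩
    · rcases hv with hv | hv
      · exact (Bool.false_ne_true hv).elim
      · exact (Nat.not_succ_le_self l hv).elim

/-- An invariant formula cannot distinguish `M` from its tree unravelling, cut at a depth that
depends only on the quantifier rank. -/
theorem InvariantFin.satFO_tree_iff [Finite I] {φ : (modalLanguage I J).Formula (Fin 1)}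
    (hφ : InvariantFin φ) (M : PointedKripke I J) [Finite M.World] :
    (tree M (2 ^ quantifierRank φ)).SatFO φ ↔ M.SatFO φ := by
  set l := 2 ^ quantifierRank φ with hl_def
  have := finite_tree M l
  have := finite_unravel M l
  have hl : unravelDepth M l (unravel M l).point ≤ l := Nat.zero_le l
  have hfin := finite_copies (unravel M l) (unravelDepth M l) l hl (quantifierRank φ + 1)
  calc (tree M l).SatFO φ
      ↔ (copies (unravel M l) (unravelDepth M l) l hl (quantifierRank φ + 1) false).SatFO φ :=
        hφ _ _ ‹_› (hfin _) (gradedBisimilar_tree_copies M l hl _)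
    _ ↔ (copies (unravel M l) (unravelDepth M l) l hl (quantifierRank φ + 1) true).SatFO φ :=
        satFO_copies_iff (isDepth_unravelDepth M l) rfl φ hl false true
    _ ↔ (unravel M l).SatFO φ := (hφ _ _ ‹_› (hfin _) (gradedBisimilar_copies _ _ _ _ _)).symm
    _ ↔ M.SatFO φ := hφ _ _ ‹_› ‹_› (gradedBisimilar_unravel M l)

/-! ### Characteristic formulas -/

open Classical in
/-- The conjunction that says which formulas of `Φ` hold: exactly those in `S`. -/
noncomputable def charFormula (Φ S : Finset (CML I J)) : CML I J :=
  Φ.toList.foldr (fun θ χ => .and (if θ ∈ S then θ else .neg θ) χ) .top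

theorem satAt_charFormula (M : PointedKripke I J) (Φ S : Finset (CML I J)) (u : M.World) :
    M.SatAt (charFormula Φ S) u ↔ ∀ θ ∈ Φ, (M.SatAt θ u ↔ θ ∈ S) := by
  classical
  simp only [← Finset.mem_toList (s := Φ), charFormula]
  induction Φ.toList with
  | nil => simp [PointedKripke.SatAt]
  | cons θ L ih =>
    simp only [List.foldr_cons, PointedKripke.SatAt, ih, List.forall_mem_cons]
    refine and_congr_left fun _ => ?_
    split_ifs with h <;> simp [PointedKripke.SatAt, h]

open Classical in
/-- The formulas of `Φ` that hold at `u`. -/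
noncomputable def typeAt (Φ : Finset (CML I J)) (M : PointedKripke I J) (u : M.World) :
    Finset (CML I J) :=
  Φ.filter fun θ => M.SatAt θ u

theorem mem_typeAt {Φ : Finset (CML I J)} {M : PointedKripke I J} {u : M.World} {θ : CML I J} :
    θ ∈ typeAt Φ M u ↔ θ ∈ Φ ∧ M.SatAt θ u := by
  simp [typeAt]

theorem satAt_charFormula_typeAt {Φ : Finset (CML I J)} {M N : PointedKripke I J} {u : M.World}
    {v : N.World} : M.SatAt (charFormula Φ (typeAt Φ N v)) u ↔ typeAt Φ M u = typeAt Φ N v := by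
  simp only [satAt_charFormula, Finset.ext_iff, mem_typeAt]
  exact forall_congr' fun θ => by tauto

theorem typeAt_eq_iff {Φ : Finset (CML I J)} {M N : PointedKripke I J} {u : M.World}
    {v : N.World} :
    typeAt Φ M u = typeAt Φ N v ↔ ∀ θ ∈ Φ, (M.SatAt θ u ↔ N.SatAt θ v) := by
  simp only [Finset.ext_iff, mem_typeAt]
  exact forall_congr' fun θ => by tauto

open Classical in
/-- Formulas of modal depth at most `d` that count up to `c`: the propositions and, for `d > 0`,
the formulas which say how many successors have a given type of depth `d - 1`. -/
noncomputable def typeFormulas [Fintype I] [Fintype J] (c : ℕ) : ℕ → Finset (CML I J)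
  | 0 => Finset.univ.image .atom
  | d + 1 => Finset.univ.image .atom ∪
      (Finset.range c ×ˢ (Finset.univ : Finset I) ×ˢ (typeFormulas c d).powerset).image
        fun x => .diam x.1.succPNat x.2.1 (charFormula (typeFormulas c d) x.2.2)

theorem atom_mem_typeFormulas [Fintype I] [Fintype J] (c d : ℕ) (j : J) :
    (CML.atom j : CML I J) ∈ typeFormulas c d := by
  cases d <;> simp [typeFormulas]

/-- Worlds of the same type of depth `d + 1` have, up to the threshold `c`, equally many successors
of each type of depth `d`. -/
theorem encard_le_of_typeAt_eq [Fintype I] [Fintype J] {c d : ℕ} {M N : PointedKripke I J}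
    {u : M.World} {u' : N.World}
    (h : typeAt (typeFormulas c (d + 1)) M u = typeAt (typeFormulas c (d + 1)) N u') (i : I)
    (v : M.World) {k : ℕ} (hk : k < c)
    (hcard : ((k + 1 : ℕ) : ℕ∞) ≤ {w | M.acc i u w ∧
      typeAt (typeFormulas c d) M w = typeAt (typeFormulas c d) M v}.encard) :
    ((k + 1 : ℕ) : ℕ∞) ≤ {w | N.acc i u' w ∧
      typeAt (typeFormulas c d) N w = typeAt (typeFormulas c d) M v}.encard := by
  classical
  have hmem : CML.diam k.succPNat i (charFormula (typeFormulas c d)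
      (typeAt (typeFormulas c d) M v)) ∈ typeFormulas c (d + 1) := by
    rw [typeFormulas, Finset.mem_union]
    refine Or.inr (Finset.mem_image.2 ⟨(k, i, typeAt (typeFormulas c d) M v), ?_, rfl⟩)
    simp [hk, typeAt]
  have := typeAt_eq_iff.1 h _ hmem
  simp only [PointedKripke.SatAt, satAt_charFormula_typeAt, Nat.succPNat_coe] at this
  exact this.1 hcard

/-! ### The game on trees -/

/-- A finite matching of paths, closed under initial segments, that respects the agents of the
steps, equality, and the types of the endpoints; the depth of the types is the remaining height. -/
structure IsTreeMatching [Fintype I] [Fintype J] (c l : ℕ) (M N : PointedKripke I J)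
    (F : Finset (List (I × M.World) × List (I × N.World))) : Prop where
  nil_mem : ([], []) ∈ F
  step : ∀ x ∈ F, x = ([], []) ∨
    ∃ i v v' p p', (p, p') ∈ F ∧ x = ((i, v) :: p, (i, v') :: p')
  eq_iff : ∀ x ∈ F, ∀ y ∈ F, x.1 = y.1 ↔ x.2 = y.2
  isPath : ∀ x ∈ F, IsPath M x.1 ∧ IsPath N x.2
  length_le : ∀ x ∈ F, x.1.length ≤ l ∧ x.2.length = x.1.length
  typeAt_eq : ∀ x ∈ F, typeAt (typeFormulas c (l - x.1.length)) M (endpoint M x.1) =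
    typeAt (typeFormulas c (l - x.1.length)) N (endpoint N x.2)

section TreeMatching

variable [Fintype I] [Fintype J] {c l : ℕ} {M N : PointedKripke I J}
  {F : Finset (List (I × M.World) × List (I × N.World))}

theorem isTreeMatching_singleton
    (h : typeAt (typeFormulas c l) M M.point = typeAt (typeFormulas c l) N N.point) :
    IsTreeMatching c l M N {([], [])} := by
  refine ⟨Finset.mem_singleton_self _, ?_, ?_, ?_, ?_, ?_⟩ <;>
    simp only [Finset.mem_singleton, forall_eq]
  · exact Or.inl trivial
  · exact ⟨trivial, trivial⟩
  · exact ⟨Nat.zero_le _, rfl⟩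
  · exact h

open Classical in
theorem IsTreeMatching.swap (hF : IsTreeMatching c l M N F) :
    IsTreeMatching c l N M (F.image Prod.swap) := by
  refine ⟨Finset.mem_image_of_mem _ hF.nil_mem, Finset.forall_mem_image.2 fun x hx => ?_,
    Finset.forall_mem_image.2 fun x hx => Finset.forall_mem_image.2 fun y hy =>
      (hF.eq_iff x hx y hy).symm,
    Finset.forall_mem_image.2 fun x hx => (hF.isPath x hx).symm,
    Finset.forall_mem_image.2 fun x hx => ?_, Finset.forall_mem_image.2 fun x hx => ?_⟩
  · rcases hF.step x hx with rfl | ⟨i, v, v', p, p', hp, rfl⟩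
    · exact Or.inl rfl
    · exact Or.inr ⟨i, v', v, p', p, Finset.mem_image_of_mem _ hp, rfl⟩
  · have := hF.length_le x hx
    exact ⟨this.2.trans_le this.1, this.2.symm⟩
  · have := hF.typeAt_eq x hx
    rw [← (hF.length_le x hx).2] at this
    exact this.symm

/-- A matched path that is extended by one step can be answered by a step to a world of the same
type that is not matched yet, since the threshold `c` exceeds the number of matched paths. -/
theorem IsTreeMatching.exists_step (hF : IsTreeMatching c l M N F) [Finite N.World]
    (hcard : F.card < c) {i : I} {v : M.World} {p : List (I × M.World)}
    {p' : List (I × N.World)} (hp : (p, p') ∈ F) (hacc : M.acc i (endpoint M p) v)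
    (hlen : p.length < l) (hnew : ∀ q, ((i, v) :: p, q) ∉ F) :
    ∃ v', N.acc i (endpoint N p') v' ∧ (∀ q, (q, (i, v') :: p') ∉ F) ∧
      typeAt (typeFormulas c (l - (p.length + 1))) M v =
        typeAt (typeFormulas c (l - (p.length + 1))) N v' := by
  classical
  by_contra! hcon
  set d := l - (p.length + 1)
  have hd : l - p.length = d + 1 := by omega
  let V : Set M.World := {w | M.acc i (endpoint M p) w ∧
    typeAt (typeFormulas c d) M w = typeAt (typeFormulas c d) M v}
  let V' : Set N.World := {w | N.acc i (endpoint N p') w ∧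
    typeAt (typeFormulas c d) N w = typeAt (typeFormulas c d) M v}
  -- All candidates for the answer are matched, with worlds of the same type other than `v`.
  have hex : ∀ w' ∈ V', ∃ w, ((i, w) :: p, (i, w') :: p') ∈ F := by
    intro w' hw'
    obtain ⟨q, hq⟩ : ∃ q, (q, (i, w') :: p') ∈ F := by
      by_contra! hq
      exact hcon w' hw'.1 hq hw'.2.symm
    rcases hF.step _ hq with h | ⟨i₁, w, w₁, r, r', hr, h⟩
    · simp at h
    · simp only [Prod.mk.injEq, List.cons.injEq] at h
      obtain ⟨rfl, ⟨rfl, rfl⟩, rfl⟩ := h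
      have : r = p := (hF.eq_iff _ hr _ hp).2 rfl
      exact ⟨w, this ▸ hq⟩
  have : Nonempty M.World := ⟨v⟩
  choose! g hg using hex
  have hV' : V'.Finite := Set.toFinite V'
  have hinj : Set.InjOn g V' := by
    intro w₁ h₁ w₂ h₂ e
    have := (hF.eq_iff _ (hg w₁ h₁) _ (hg w₂ h₂)).1 (by simp [e])
    simpa using this
  have hmaps : ∀ w ∈ V', g w ∈ V := by
    intro w hw
    refine ⟨(hF.isPath _ (hg w hw)).1.1, ?_⟩
    have := hF.typeAt_eq _ (hg w hw)
    rw [List.length_cons] at this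
    exact this.trans hw.2
  have hvV : v ∈ V := ⟨hacc, rfl⟩
  have hv : v ∉ g '' V' := by
    rintro ⟨w, hw, e⟩
    exact hnew _ (e ▸ hg w hw)
  have hlt : V'.ncard < c := by
    refine lt_of_le_of_lt ?_ hcard
    rw [← Set.ncard_coe_finset]
    refine Set.ncard_le_ncard_of_injOn (fun w => ((i, g w) :: p, (i, w) :: p')) hg ?_
      F.finite_toSet
    intro w₁ _ w₂ _ e
    simpa using (Prod.ext_iff.1 e).2
  have hle : ((V'.ncard + 1 : ℕ) : ℕ∞) ≤ V.encard := by
    calc ((V'.ncard + 1 : ℕ) : ℕ∞) = (insert v (g '' V')).encard := by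
          rw [Set.encard_insert_of_notMem hv, hinj.encard_image, ← hV'.cast_ncard_eq]
          push_cast
          rfl
      _ ≤ V.encard := Set.encard_le_encard (Set.insert_subset hvV (Set.image_subset_iff.2 hmaps))
  have htype := hF.typeAt_eq _ hp
  simp only [hd] at htype
  have := encard_le_of_typeAt_eq htype i v hlt hle
  change _ ≤ V'.encard at this
  rw [← hV'.cast_ncard_eq] at this
  exact absurd (Nat.cast_le.1 this) (Nat.not_succ_le_self _)

open Classical in
theorem IsTreeMatching.insert (hF : IsTreeMatching c l M N F) {i : I} {v : M.World}
    {v' : N.World} {p : List (I × M.World)} {p' : List (I × N.World)} (hp : (p, p') ∈ F)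
    (hacc : M.acc i (endpoint M p) v) (hacc' : N.acc i (endpoint N p') v') (hlen : p.length < l)
    (hnew : ∀ q, ((i, v) :: p, q) ∉ F) (hnew' : ∀ q, (q, (i, v') :: p') ∉ F)
    (htype : typeAt (typeFormulas c (l - (p.length + 1))) M v =
      typeAt (typeFormulas c (l - (p.length + 1))) N v') :
    IsTreeMatching c l M N (insert ((i, v) :: p, (i, v') :: p') F) := by
  refine ⟨Finset.mem_insert_of_mem hF.nil_mem, ?_, ?_, ?_, ?_, ?_⟩ <;>
    simp only [Finset.forall_mem_insert]
  · refine ⟨Or.inr ⟨i, v, v', p, p', Finset.mem_insert_of_mem hp, rfl⟩, fun x hx => ?_⟩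
    refine (hF.step x hx).imp_right ?_
    rintro ⟨i, v, v', r, r', hr, rfl⟩
    exact ⟨i, v, v', r, r', Finset.mem_insert_of_mem hr, rfl⟩
  · refine ⟨⟨trivial, ?_⟩, fun x hx => ⟨?_, hF.eq_iff x hx⟩⟩
    · rintro ⟨y₁, y₂⟩ hy
      exact iff_of_false (by rintro rfl; exact hnew _ hy) (by rintro rfl; exact hnew' _ hy)
    · obtain ⟨x₁, x₂⟩ := x
      exact iff_of_false (by rintro rfl; exact hnew _ hx) (by rintro rfl; exact hnew' _ hx)
  · exact ⟨⟨⟨hacc, (hF.isPath _ hp).1⟩, hacc', (hF.isPath _ hp).2⟩, hF.isPath⟩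
  · exact ⟨⟨hlen, congrArg (· + 1) (hF.length_le _ hp).2⟩, hF.length_le⟩
  · exact ⟨htype, hF.typeAt_eq⟩

theorem IsTreeMatching.exists_extension [Finite N.World] (p : List (I × M.World)) :
    ∀ {F : Finset (List (I × M.World) × List (I × N.World))}, IsTreeMatching c l M N F →
      IsPath M p → p.length ≤ l → F.card + p.length ≤ c →
      ∃ F' p', F ⊆ F' ∧ IsTreeMatching c l M N F' ∧ (p, p') ∈ F' ∧
        F'.card ≤ F.card + p.length := by
  classical
  induction p with
  | nil =>
    intro F hF _ _ _
    exact ⟨F, [], subset_rfl, hF, hF.nil_mem, le_rfl⟩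
  | cons s p ih =>
    obtain ⟨i, v⟩ := s
    intro F hF hpath hlen hcard
    rw [List.length_cons] at hlen hcard
    obtain ⟨F₁, p', hsub, hF₁, hp, hcard₁⟩ := ih hF hpath.2 (by omega) (by omega)
    by_cases hnew : ∃ q, ((i, v) :: p, q) ∈ F₁
    · obtain ⟨q, hq⟩ := hnew
      exact ⟨F₁, q, hsub, hF₁, hq, by rw [List.length_cons]; omega⟩
    · push Not at hnew
      obtain ⟨v', hacc', hnew', htype⟩ :=
        hF₁.exists_step (by omega) hp hpath.1 (by omega) hnew
      refine ⟨Insert.insert ((i, v) :: p, (i, v') :: p') F₁, (i, v') :: p',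
        hsub.trans (Finset.subset_insert _ _),
        hF₁.insert hp hpath.1 hacc' (by omega) hnew hnew' htype,
        Finset.mem_insert_self _ _, ?_⟩
      rw [List.length_cons]
      exact (Finset.card_insert_le _ _).trans (by omega)

theorem IsTreeMatching.acc_imp (hF : IsTreeMatching c l M N F)
    {x y : (tree M l).World × (tree N l).World} (hx : (x.1.1, x.2.1) ∈ F)
    (hy : (y.1.1, y.2.1) ∈ F) {i : I} (h : (tree M l).acc i x.1 y.1) :
    (tree N l).acc i x.2 y.2 := by
  obtain ⟨v, hv⟩ := h
  rcases hF.step _ hy with h | ⟨i₁, w, w', p, p', hp, h⟩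
  · simp [hv] at h
  · simp only [Prod.mk.injEq, hv, List.cons.injEq] at h
    obtain ⟨⟨⟨rfl, rfl⟩, rfl⟩, h⟩ := h
    have hp' : p' = x.2.1 := (hF.eq_iff _ hp _ hx).1 rfl
    exact ⟨w', h.trans (congrArg _ hp')⟩

/-- The positions of the game on two trees that are covered by a matching with at most
`c - m * l` elements, so that `m` further rounds can be answered. -/
def TreePosition (c l : ℕ) (M N : PointedKripke I J) (m : ℕ)
    (L : List ((tree M l).World × (tree N l).World)) : Prop :=
  ∃ F, IsTreeMatching c l M N F ∧ (∀ x ∈ L, (x.1.1, x.2.1) ∈ F) ∧ F.card + m * l ≤ c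

open Classical in
theorem TreePosition.swap {m : ℕ} {L : List ((tree M l).World × (tree N l).World)}
    (h : TreePosition c l M N m L) : TreePosition c l N M m (L.map Prod.swap) := by
  obtain ⟨F, hF, hL, hcard⟩ := h
  refine ⟨F.image Prod.swap, hF.swap, fun x hx => ?_,
    (Nat.add_le_add_right Finset.card_image_le _).trans hcard⟩
  obtain ⟨x, hx', rfl⟩ := List.mem_map.1 hx
  exact Finset.mem_image_of_mem _ (hL x hx')

theorem TreePosition.forth [Finite N.World] {m : ℕ}
    {L : List ((tree M l).World × (tree N l).World)} (h : TreePosition c l M N (m + 1) L)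
    (a : (tree M l).World) : ∃ b, TreePosition c l M N m ((a, b) :: L) := by
  obtain ⟨F, hF, hL, hcard⟩ := h
  rw [add_mul, one_mul] at hcard
  have ha := a.2.2
  obtain ⟨F', p', hsub, hF', hp', hcard'⟩ := hF.exists_extension a.1 a.2.1 ha (by omega)
  have hlen := (hF'.length_le _ hp').2
  refine ⟨⟨p', (hF'.isPath _ hp').2, hlen.trans_le ha⟩, F', hF', fun x hx => ?_, by omega⟩
  rcases List.mem_cons.1 hx with rfl | hx
  exacts [hp', hsub (hL x hx)]

theorem isStrategy_treePosition [Finite M.World] [Finite N.World] :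
    IsStrategy (tree M l) (tree N l) (TreePosition c l M N) where
  isPartialIso := by
    rintro m L ⟨F, hF, hL, -⟩
    refine ⟨fun x hx y hy => ?_, fun x hx y hy i => ⟨hF.acc_imp (hL x hx) (hL y hy), ?_⟩,
      fun x hx j => ?_⟩
    · exact Subtype.ext_iff.trans ((hF.eq_iff _ (hL x hx) _ (hL y hy)).trans
        Subtype.ext_iff.symm)
    · classical
      exact hF.swap.acc_imp (x := x.swap) (y := y.swap) (Finset.mem_image_of_mem _ (hL x hx))
        (Finset.mem_image_of_mem _ (hL y hy))
    · exact typeAt_eq_iff.1 (hF.typeAt_eq _ (hL x hx)) _ (atom_mem_typeFormulas c _ j)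
  forth m L h a := h.forth a
  back m L h b := by
    obtain ⟨a, ha⟩ := h.swap.forth b
    refine ⟨a, ?_⟩
    simpa [Function.comp_def] using ha.swap

end TreeMatching

theorem satFO_tree_iff_of_typeAt_eq [Fintype I] [Fintype J] {M N : PointedKripke I J}
    [Finite M.World] [Finite N.World] (φ : (modalLanguage I J).Formula (Fin 1)) {c l : ℕ}
    (hc : 1 + quantifierRank φ * l ≤ c)
    (h : typeAt (typeFormulas c l) M M.point = typeAt (typeFormulas c l) N N.point) :
    (tree M l).SatFO φ ↔ (tree N l).SatFO φ := by
  refine isStrategy_treePosition.satFO_iff φ ⟨_, isTreeMatching_singleton h, fun x hx => ?_, hc⟩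
  rw [List.mem_singleton.1 hx]
  exact Finset.mem_singleton_self _

/-! ### Expressing invariant formulas -/

theorem exists_disjunction (T : Finset (CML I J)) :
    ∃ ψ : CML I J, ∀ (M : PointedKripke I J) (u : M.World),
      M.SatAt ψ u ↔ ∃ χ ∈ T, M.SatAt χ u := by
  classical
  induction T using Finset.induction_on with
  | empty => exact ⟨.neg .top, fun M u => by simp [PointedKripke.SatAt]⟩
  | insert χ T _ ih =>
    obtain ⟨ψ, hψ⟩ := ih
    exact ⟨.or χ ψ, fun M u => by simp [PointedKripke.SatAt, hψ]⟩

/-- A formula the truth of which depends only on the type of the distinguished world with respect to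
a finite set `Φ` is equivalent to a disjunction of characteristic formulas. -/
theorem exists_equivFin_of_typeAt (φ : (modalLanguage I J).Formula (Fin 1))
    (Φ : Finset (CML I J))
    (h : ∀ M N : PointedKripke I J, Finite M.World → Finite N.World →
      typeAt Φ M M.point = typeAt Φ N N.point → (M.SatFO φ ↔ N.SatFO φ)) :
    ∃ ψ, EquivFin φ ψ := by
  classical
  obtain ⟨ψ, hψ⟩ := exists_disjunction ((Φ.powerset.filter fun S => ∃ N : PointedKripke I J,
    Finite N.World ∧ N.SatFO φ ∧ typeAt Φ N N.point = S).image (charFormula Φ))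
  refine ⟨ψ, fun M hM => ?_⟩
  rw [PointedKripke.SatCML, hψ]
  constructor
  · intro hφ
    refine ⟨_, Finset.mem_image_of_mem _ (Finset.mem_filter.2
      ⟨?_, M, hM, hφ, rfl⟩), satAt_charFormula_typeAt.2 rfl⟩
    simp [typeAt]
  · rintro ⟨χ, hχ, hsat⟩
    obtain ⟨S, hS, rfl⟩ := Finset.mem_image.1 hχ
    obtain ⟨-, N, hN, hφ, rfl⟩ := Finset.mem_filter.1 hS
    exact (h M N hM hN (satAt_charFormula_typeAt.1 hsat)).2 hφ

end GradedModal

theorem theorem2 {I J : Type u} [Finite I] [Finite J]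
    (φ : (GradedModal.modalLanguage I J).Formula (Fin 1)) :
    GradedModal.InvariantFin φ ↔ ∃ ψ : GradedModal.CML I J, GradedModal.EquivFin φ ψ := by
  constructor
  · intro hφ
    have := Fintype.ofFinite I
    have := Fintype.ofFinite J
    refine GradedModal.exists_equivFin_of_typeAt φ (GradedModal.typeFormulas
      (1 + GradedModal.quantifierRank φ * 2 ^ GradedModal.quantifierRank φ)
      (2 ^ GradedModal.quantifierRank φ)) fun M N _ _ h => ?_
    rw [← hφ.satFO_tree_iff M, ← hφ.satFO_tree_iff N]
    exact GradedModal.satFO_tree_iff_of_typeAt_eq φ le_rfl h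
  · rintro ⟨ψ, hψ⟩ M N hM hN ⟨Z, hZ, hpoint⟩
    rw [hψ M hM, hψ N hN]
    exact hZ.satAt_iff ψ hpoint
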